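/- All polynomials are over $\mathbb{C}$. An algebraic formula is a tree whose leaves are labelled by constants or variables and whose inner nodes are product gates or sum gates of arbitrary positive fan-in, the edges into a sum gate carrying constants (so that it computes a linear combination of its children). Its size is its number of nodes, its depth the number of edges on a longest root-to-leaf path. An algebraic branching program (ABP) is a layered directed graph with a single source in the first layer and a single sink in the last, each edge going from one layer to the next and being labelled by a polynomial of degree at most $1$; it computes the sum over all source-sink paths of the product of the labels, and its size is its number of vertices. $\mathrm{VF}$ (resp. $\mathrm{VBP}$) is the class of sequences $(f_k)_{k\ge 0}$ of polynomials in $\mathrm{poly}(k)$ many variables that have formulas (resp. ABPs) of size $\mathrm{poly}(k)$. For $\lambda=(\lambda_1\ge\dots\ge\lambda_\ell)$ and $n\ge \ell$, with $\lambda_j=0$ for $j>\ell$, the Schur polynomial is $$s_\lambda(x_1,\dots,x_n)=\frac{\det\big((x_i^{\lambda_j+n-j})_{i,j\in[n]}\big)}{\det\big((x_i^{n-j})_{i,j\in[n]}\big)}.$$ Call $(\lambda,n)$, with $\lambda=(\lambda_1,\dots,\lambda_\ell)$ and $\ell\ge 1$, admissible if $\lambda_i\ge\lambda_{i+1}+(\ell-1)$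 for all $1\le i<\ell$, $\lambda_\ell\ge \ell$, and $n\ge\lambda_1+\ell$. Theorem. (1) There are a polynomial $P$ and a constant $c$, both absolute, such that for every admissible $(\lambda,n)$ and all $s,\Delta$: if $s_\lambda(x_1,\dots,x_n)$ has an algebraic formula of size at most $s$ and depth at most $\Delta$, then the $\ell\times\ell$ symbolic determinant $\det\big((x_{ij})_{i,j\in[\ell]}\big)$ has an algebraic formula of size at most $P(s)$ and depth at most $\Delta+c$. (2) Let $(\lambda^{(k)},n_k)_{k\ge 0}$ be a sequence of admissible pairs whose lengths $\ell_k$ satisfy $k\le p(\ell_k)$ for all $k$ and some fixed polynomial $p$. If $\mathrm{VBP}\ne\mathrm{VF}$, then the Schur polynomials $s_{\lambda^{(k)}}(x_1,\dots,x_{n_k})$ do not have algebraic formulas of size polynomial in $k$. (3) There are sequences as in (2) with, in addition, $n_k$ bounded by a polynomial in $k$ (so that $k$, $\ell_k$, $n_k$ and $\sum_i\lambda^{(k)}_i$ are all polynomially related). -/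

import Mathlib

open MvPolynomial

noncomputable section

/-! ### Schur polynomials (bialternant definition) -/

/-- The sequence `λ = (λ_1, …, λ_ℓ)` continued by zeros; indices start at `0`. -/
def extendByZero {ℓ : ℕ} (lam : Fin ℓ → ℕ) (j : ℕ) : ℕ :=
  if h : j < ℓ then lam ⟨j, h⟩ else 0

/-- The determinant of `(x_i ^ (λ_j + n - j))`, `1 ≤ i, j ≤ n`
(with the zero-based column index `j` the exponent reads `λ_j + (n - 1 - j)`). -/
def alternant {ℓ : ℕ} (lam : Fin ℓ → ℕ) (n : ℕ) : MvPolynomial (Fin n) ℂ :=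
  Matrix.det (Matrix.of fun i j : Fin n =>
    (X i : MvPolynomial (Fin n) ℂ) ^ (extendByZero lam j + (n - 1 - (j : ℕ))))

/-- The determinant of `(x_i ^ (n - j))`, `1 ≤ i, j ≤ n`. -/
def vandermondeDet (n : ℕ) : MvPolynomial (Fin n) ℂ :=
  Matrix.det (Matrix.of fun i j : Fin n =>
    (X i : MvPolynomial (Fin n) ℂ) ^ (n - 1 - (j : ℕ)))

/-- The quotient that defines the Schur polynomial is a polynomial. -/
theorem vandermondeDet_dvd_alternant {ℓ : ℕ} (lam : Fin ℓ → ℕ) (n : ℕ) :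
    vandermondeDet n ∣ alternant lam n := by
  classical
  set P : Polynomial (MvPolynomial (Fin n) ℂ) :=
    ∏ i : Fin n, (Polynomial.X - Polynomial.C (X i)) with hP
  have hPm : P.Monic := Polynomial.monic_prod_of_monic _ _ fun i _ => Polynomial.monic_X_sub_C _
  have hdeg : P.natDegree = n := by
    rw [hP, Polynomial.natDegree_prod_of_monic _ _ fun i _ => Polynomial.monic_X_sub_C _]
    simp
  have key : ∀ (i : Fin n) (m : ℕ), (X i : MvPolynomial (Fin n) ℂ) ^ m =
      ∑ k : Fin n, X i ^ (n - 1 - (k : ℕ)) *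
        ((Polynomial.X ^ m) %ₘ P).coeff (n - 1 - (k : ℕ)) := by
    intro i m
    have hroot : P.eval (X i) = 0 := by
      rw [hP, Polynomial.eval_prod]
      exact Finset.prod_eq_zero (Finset.mem_univ i) (by simp)
    have h1 := congrArg (Polynomial.eval (X i : MvPolynomial (Fin n) ℂ))
      (Polynomial.modByMonic_add_div (Polynomial.X ^ m) P)
    rw [Polynomial.eval_add, Polynomial.eval_mul, hroot, zero_mul, add_zero,
      Polynomial.eval_pow, Polynomial.eval_X] at h1
    have hn : 0 < n := i.pos
    have hlt : ((Polynomial.X ^ m) %ₘ P).natDegree < n := by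
      have := Polynomial.natDegree_modByMonic_lt (Polynomial.X ^ m) hPm
        (by intro h; rw [h] at hdeg; simp at hdeg; omega)
      omega
    rw [← h1, Polynomial.eval_eq_sum_range' hlt, ← Finset.sum_range_reflect,
      Finset.sum_range]
    exact Finset.sum_congr rfl fun k _ => mul_comm _ _
  refine ⟨Matrix.det (Matrix.of fun k j : Fin n =>
    ((Polynomial.X ^ (extendByZero lam j + (n - 1 - (j : ℕ)))) %ₘ P).coeff (n - 1 - (k : ℕ))), ?_⟩
  rw [vandermondeDet, ← Matrix.det_mul, alternant]
  congr 1
  ext1 i j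
  rw [Matrix.mul_apply, Matrix.of_apply, key i]
  rfl

/-- The Schur polynomial `s_λ(x_1, …, x_n)`, for `n ≥ ℓ`: the quotient of the alternant of `λ` by
the Vandermonde determinant (unique, because the latter is a nonzero element of a domain). -/
def schurPoly {ℓ : ℕ} (lam : Fin ℓ → ℕ) (n : ℕ) : MvPolynomial (Fin n) ℂ :=
  (vandermondeDet_dvd_alternant lam n).choose

theorem vandermondeDet_mul_schurPoly {ℓ : ℕ} (lam : Fin ℓ → ℕ) (n : ℕ) :
    vandermondeDet n * schurPoly lam n = alternant lam n :=
  (vandermondeDet_dvd_alternant lam n).choose_spec.symm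

/-! ### Algebraic formulas -/

/-- Algebraic formulas over `ℂ` in variables indexed by `σ`: trees whose leaves carry constants or
variables, and whose inner nodes are product gates, or sum gates with constants on the incoming
edges. Gates have any positive number `m + 1` of children. -/
inductive AlgFormula (σ : Type) : Type
  | const (c : ℂ) : AlgFormula σ
  | var (i : σ) : AlgFormula σ
  | sum (m : ℕ) (c : Fin (m + 1) → ℂ) (f : Fin (m + 1) → AlgFormula σ) : AlgFormula σ
  | prod (m : ℕ) (f : Fin (m + 1) → AlgFormula σ) : AlgFormula σ

namespace AlgFormula

/-- The polynomial computed by a formula. -/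
def eval {σ : Type} : AlgFormula σ → MvPolynomial σ ℂ
  | const c => C c
  | var i => X i
  | sum _ c f => ∑ i, C (c i) * (f i).eval
  | prod _ f => ∏ i, (f i).eval

/-- The number of nodes, leaves included. -/
def size {σ : Type} : AlgFormula σ → ℕ
  | const _ => 1
  | var _ => 1
  | sum _ _ f => 1 + ∑ i, (f i).size
  | prod _ f => 1 + ∑ i, (f i).size

/-- The number of edges of a longest path from a leaf to the root. -/
def depth {σ : Type} : AlgFormula σ → ℕ
  | const _ => 0
  | var _ => 0
  | sum _ _ f => 1 + Finset.univ.sup fun i => (f i).depth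
  | prod _ f => 1 + Finset.univ.sup fun i => (f i).depth

end AlgFormula

/-- `p` has a formula of size at most `s` and depth at most `Δ`. -/
def HasFormula {σ : Type} (p : MvPolynomial σ ℂ) (s Δ : ℕ) : Prop :=
  ∃ F : AlgFormula σ, F.eval = p ∧ F.size ≤ s ∧ F.depth ≤ Δ

/-- `p` has a formula of size at most `s` (and any depth). -/
def HasFormulaOfSize {σ : Type} (p : MvPolynomial σ ℂ) (s : ℕ) : Prop :=
  ∃ F : AlgFormula σ, F.eval = p ∧ F.size ≤ s

/-! ### Algebraic branching programs -/

/-- Algebraic branching programs over `ℂ`: layers `0, …, len` with `width i` vertices in layer `i`,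
a single source in the first and a single sink in the last layer, and an edge label of degree at
most one for every pair of vertices in consecutive layers (the label is `0` if there is no edge). -/
structure ABP (σ : Type) where
  len : ℕ
  width : Fin (len + 1) → ℕ
  width_source : width 0 = 1
  width_sink : width (Fin.last len) = 1
  label : ∀ i : Fin len, Fin (width i.castSucc) → Fin (width i.succ) → MvPolynomial σ ℂ
  label_linear : ∀ i u v, (label i u v).totalDegree ≤ 1

namespace ABP

/-- The polynomial computed by an ABP: the sum over all source-sink paths (one vertex from each
layer) of the product of the labels along the path. -/
def eval {σ : Type} (B : ABP σ) : MvPolynomial σ ℂ :=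
  ∑ path : (∀ i : Fin (B.len + 1), Fin (B.width i)),
    ∏ i : Fin B.len, B.label i (path i.castSucc) (path i.succ)

/-- The number of vertices. -/
def size {σ : Type} (B : ABP σ) : ℕ := ∑ i, B.width i

end ABP

/-! ### Polynomial families and the classes `VF` and `VBP` -/

/-- `f k ≤ poly(k)`. -/
def PolyBounded (f : ℕ → ℕ) : Prop :=
  ∃ p : Polynomial ℕ, ∀ k, f k ≤ p.eval k

/-- A sequence of polynomials over `ℂ`, the `k`-th one in the variables `x_1, …, x_{vars k}`. -/
structure PolyFamily where
  vars : ℕ → ℕ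
  poly : ∀ k, MvPolynomial (Fin (vars k)) ℂ

/-- The family has formulas of polynomial size. -/
def PolyFamily.HasPolySizeFormulas (f : PolyFamily) : Prop :=
  ∃ s : ℕ → ℕ, PolyBounded s ∧ ∀ k, HasFormulaOfSize (f.poly k) (s k)

/-- The family has algebraic branching programs of polynomial size. -/
def PolyFamily.HasPolySizeABPs (f : PolyFamily) : Prop :=
  ∃ s : ℕ → ℕ, PolyBounded s ∧ ∀ k, ∃ B : ABP (Fin (f.vars k)), B.eval = f.poly k ∧ B.size ≤ s k

/-- Families in polynomially many variables with formulas of polynomial size. (The degrees are then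
polynomially bounded as well, since a formula of size `s` has degree at most `s`.) -/
def VF : Set PolyFamily := {f | PolyBounded f.vars ∧ f.HasPolySizeFormulas}

/-- Families in polynomially many variables with ABPs of polynomial size. (The degrees are then
polynomially bounded as well, since an ABP of size `s` has degree less than `s`.) -/
def VBP : Set PolyFamily := {f | PolyBounded f.vars ∧ f.HasPolySizeABPs}

/-! ### The partitions under consideration -/

/-- `λ = (λ_1, …, λ_ℓ)` with `ℓ ≥ 1`, `λ_i ≥ λ_{i+1} + (ℓ - 1)` for `1 ≤ i < ℓ`, `λ_ℓ ≥ ℓ`, and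
`n ≥ λ_1 + ℓ`. -/
structure WellSpaced {ℓ : ℕ} (lam : Fin ℓ → ℕ) (n : ℕ) : Prop where
  length_pos : 0 < ℓ
  gap : ∀ i j : Fin ℓ, (i : ℕ) + 1 = j → lam j + (ℓ - 1) ≤ lam i
  last_ge : ∀ i : Fin ℓ, (i : ℕ) + 1 = ℓ → ℓ ≤ lam i
  first_le : ∀ i : Fin ℓ, (i : ℕ) = 0 → lam i + ℓ ≤ n

/-- The family of the Schur polynomials `s_{λ^(k)}(x_1, …, x_{n_k})`, `k = 0, 1, 2, …`. -/
def schurFamily {ℓ : ℕ → ℕ} (lam : ∀ k, Fin (ℓ k) → ℕ) (n : ℕ → ℕ) : PolyFamily where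
  vars := n
  poly k := schurPoly (lam k) (n k)

end

/-! Modulo `∏ (X - x_i)`, a power of `x_i` is a combination of `1, x_i, …, x_i ^ (n - 1)` with
coefficients that do not depend on `i`. Comparing with the Vandermonde matrix writes `s_λ` as an `ℓ
× ℓ` determinant of such coefficients (`schurPoly_eq_det`), a Jacobi–Trudi formula.

Now substitute `x_i = ζ^i + t L_i(y)`, with `ζ` a primitive `n`-th root of unity and `L_i` linear
forms in `ℓ²` new variables. At `t = 0` the modulus is `X^n - 1`, and the entries of the determinant
vanish. Their coefficients at `t` are the Fourier sums `∑ ζ^(i (k + r_j)) L_i`, where `r_j = λ_j - 1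
- j` with indices from zero (`coeff_of_linear_pow_eq_sum`). For well-spaced `λ` the frequencies `k +
r_j` are distinct and lie in `[0, n)`, so an inverse Fourier transform provides `L_i` for which
these sums are the variables `y_kj`. Hence `det (y_kj)` is the coefficient of `t^ℓ` in the
substituted `s_λ`. Interpolation in `t` extracts it from a formula at the cost of affine leaves and
one sum gate on top.

For the classes: an ABP with `m` vertices is an `m × m` determinant with affine entries, so small
formulas for determinants give `VBP ⊆ VF`. The converse inclusion serialises a formula into a
sequence of affine combinations of earlier terms and unrolls it into layers. -/

noncomputable section

/-! ### Operations on formulas -/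

namespace AlgFormula

variable {σ τ : Type}

/-- Replace every variable leaf by a formula. -/
def subst (φ : σ → AlgFormula τ) : AlgFormula σ → AlgFormula τ
  | const c => const c
  | var i => φ i
  | sum m c f => sum m c fun i => (f i).subst φ
  | prod m f => prod m fun i => (f i).subst φ

theorem eval_subst (φ : σ → AlgFormula τ) (F : AlgFormula σ) :
    (F.subst φ).eval = aeval (fun i => (φ i).eval) F.eval := by
  induction F with
  | const c => simp [subst, eval]
  | var i => simp [subst, eval]
  | sum m c f ih => simp [subst, eval, ih]
  | prod m f ih => simp [subst, eval, ih]

theorem size_subst_le (φ : σ → AlgFormula τ) {b : ℕ} (hb : 1 ≤ b) (hφ : ∀ i, (φ i).size ≤ b)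
    (F : AlgFormula σ) : (F.subst φ).size ≤ F.size * b := by
  induction F with
  | const c => simpa [subst, size] using hb
  | var i => simpa [subst, size] using hφ i
  | sum m c f ih =>
    simp only [subst, size, add_mul, one_mul, Finset.sum_mul]
    exact add_le_add hb (Finset.sum_le_sum fun i _ => ih i)
  | prod m f ih =>
    simp only [subst, size, add_mul, one_mul, Finset.sum_mul]
    exact add_le_add hb (Finset.sum_le_sum fun i _ => ih i)

theorem depth_subst_le (φ : σ → AlgFormula τ) {d : ℕ} (hφ : ∀ i, (φ i).depth ≤ d)
    (F : AlgFormula σ) : (F.subst φ).depth ≤ F.depth + d := by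
  have key : ∀ (m : ℕ) (f : Fin (m + 1) → AlgFormula σ),
      (∀ i, ((f i).subst φ).depth ≤ (f i).depth + d) →
      1 + (Finset.univ.sup fun i => ((f i).subst φ).depth) ≤
        1 + (Finset.univ.sup fun i => (f i).depth) + d := by
    intro m f ih
    rw [add_assoc]
    refine add_le_add le_rfl (Finset.sup_le fun i hi => (ih i).trans (add_le_add ?_ le_rfl))
    exact Finset.le_sup (f := fun i => (f i).depth) hi
  induction F with
  | const c => simp [subst, depth]
  | var i => simpa [subst, depth] using hφ i
  | sum m c f ih => simpa only [subst, depth] using key m f ih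
  | prod m f ih => simpa only [subst, depth] using key m f ih

/-- Bounds the number of interpolation nodes by the formula size, independently of `λ` and `n`. -/
theorem totalDegree_eval_le_size (F : AlgFormula σ) : F.eval.totalDegree ≤ F.size := by
  induction F with
  | const c => simp [eval, size]
  | var i => simp [eval, size]
  | sum m c f ih =>
    simp only [eval, size]
    refine totalDegree_finsetSum_le fun i hi => ?_
    have h1 : (C (c i) * (f i).eval).totalDegree ≤ (f i).eval.totalDegree :=
      (totalDegree_mul _ _).trans (by simp)
    have h2 : (f i).size ≤ ∑ i, (f i).size :=
      Finset.single_le_sum (f := fun i => (f i).size) (fun _ _ => Nat.zero_le _) hi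
    have := ih i
    omega
  | prod m f ih =>
    simp only [eval, size]
    refine (totalDegree_finsetProd _ _).trans ?_
    have := Finset.sum_le_sum fun i (_ : i ∈ Finset.univ) => ih i
    omega

end AlgFormula

/-! ### Closure properties of the size and depth bounds -/

section HasFormula

variable {σ τ : Type}

theorem HasFormula.mono {p : MvPolynomial σ ℂ} {s s' d d' : ℕ} (h : HasFormula p s d)
    (hs : s ≤ s') (hd : d ≤ d') : HasFormula p s' d' :=
  let ⟨F, hF, h1, h2⟩ := h
  ⟨F, hF, h1.trans hs, h2.trans hd⟩

theorem HasFormula.totalDegree_le {p : MvPolynomial σ ℂ} {s d : ℕ} (h : HasFormula p s d) :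
    p.totalDegree ≤ s :=
  let ⟨F, hF, h1, _⟩ := h
  hF ▸ F.totalDegree_eval_le_size.trans h1

theorem hasFormula_C (c : ℂ) : HasFormula (C c : MvPolynomial σ ℂ) 1 0 :=
  ⟨.const c, rfl, le_rfl, le_rfl⟩

theorem hasFormula_X (i : σ) : HasFormula (X i : MvPolynomial σ ℂ) 1 0 :=
  ⟨.var i, rfl, le_rfl, le_rfl⟩

theorem HasFormula.aeval {p : MvPolynomial σ ℂ} {s d b e : ℕ} (h : HasFormula p s d)
    (g : σ → MvPolynomial τ ℂ) (hb : 1 ≤ b) (hg : ∀ i, HasFormula (g i) b e) :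
    HasFormula (MvPolynomial.aeval g p) (s * b) (d + e) := by
  obtain ⟨F, rfl, h1, h2⟩ := h
  choose φ hφ hs hd using hg
  refine ⟨F.subst φ, ?_, (F.size_subst_le φ hb hs).trans (Nat.mul_le_mul_right _ h1),
    (F.depth_subst_le φ hd).trans (add_le_add h2 le_rfl)⟩
  rw [AlgFormula.eval_subst]
  simp only [hφ]

theorem HasFormula.sum {ι : Type*} [Fintype ι] [Nonempty ι] {p : ι → MvPolynomial σ ℂ} {s d : ℕ}
    (c : ι → ℂ) (h : ∀ i, HasFormula (p i) s d) :
    HasFormula (∑ i, C (c i) * p i) (1 + Fintype.card ι * s) (d + 1) := by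
  choose F hF hs hd using h
  obtain ⟨m, hm⟩ : ∃ m, Fintype.card ι = m + 1 :=
    Nat.exists_eq_succ_of_ne_zero Fintype.card_ne_zero
  let e : Fin (m + 1) ≃ ι := (Fintype.equivFinOfCardEq hm).symm
  refine ⟨.sum m (c ∘ e) (F ∘ e), ?_, ?_, ?_⟩
  · simp only [AlgFormula.eval, Function.comp, hF]
    exact e.sum_comp fun i => C (c i) * p i
  · simp only [AlgFormula.size, Function.comp]
    have := Finset.sum_le_card_nsmul Finset.univ (fun i => (F (e i)).size) s fun i _ => hs _
    simp only [Finset.card_univ, Fintype.card_fin, smul_eq_mul] at this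
    rw [hm]
    omega
  · simp only [AlgFormula.depth, Function.comp]
    rw [add_comm]
    exact add_le_add (Finset.sup_le fun i _ => hd _) le_rfl

theorem hasFormula_affine [Fintype τ] (a : ℂ) (b : τ → ℂ) :
    HasFormula (C a + ∑ i, C (b i) * X i : MvPolynomial τ ℂ) (Fintype.card τ + 2) 1 := by
  -- The constant term is an edge weight on an extra leaf `1`, so one sum gate suffices.
  have h := HasFormula.sum (σ := τ) (ι := Option τ) (s := 1) (d := 0)
    (p := fun o => o.elim 1 X) (fun o => o.elim a b) (by
      rintro (_ | i)
      · simpa using hasFormula_C (σ := τ) 1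
      · exact hasFormula_X i)
  rw [Fintype.sum_option] at h
  simp only [Option.elim, mul_one] at h
  exact h.mono (by simp; omega) le_rfl

theorem eq_affine_of_totalDegree_le_one [Fintype τ] (p : MvPolynomial τ ℂ)
    (hp : p.totalDegree ≤ 1) :
    p = C (coeff 0 p) + ∑ i, C (coeff (Finsupp.single i 1) p) * X i := by
  classical
  ext d
  simp only [coeff_add, coeff_C, coeff_sum, coeff_C_mul, coeff_X]
  rcases lt_trichotomy d.degree 1 with h | h | h
  · have hd : d = 0 := (Finsupp.degree_eq_zero_iff d).1 (Nat.lt_one_iff.1 h)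
    subst hd
    simp
  · obtain ⟨i, rfl⟩ := (Finsupp.sum_eq_one_iff d).1 h
    have h0 : (0 : τ →₀ ℕ) ≠ Finsupp.single i 1 := fun h0 => by simp [← h0] at h
    simp [Finsupp.single_left_inj, h0]
  · have h0 : coeff d p = 0 := coeff_eq_zero_of_totalDegree_lt (by
      have : d.degree = ∑ i ∈ d.support, d i := rfl
      omega)
    rw [h0, if_neg (by rintro rfl; simp at h)]
    rw [Finset.sum_eq_zero, add_zero]
    intro i _
    rw [if_neg (by rintro rfl; simp at h), mul_zero]

theorem hasFormula_of_totalDegree_le_one [Fintype τ] (p : MvPolynomial τ ℂ)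
    (hp : p.totalDegree ≤ 1) : HasFormula p (Fintype.card τ + 2) 1 := by
  rw [eq_affine_of_totalDegree_le_one p hp]
  exact hasFormula_affine _ _

end HasFormula

/-! ### Extraction of a coefficient by interpolation -/

/-- The weights are row `l` of the inverse Vandermonde matrix at the nodes `0, …, D`. -/
theorem exists_interpolation_weights (D l : ℕ) (hl : l ≤ D) : ∃ c : Fin (D + 1) → ℂ,
    ∀ d ≤ D, ∑ j, c j * ((j : ℕ) : ℂ) ^ d = if d = l then 1 else 0 := by
  classical
  let V : Matrix (Fin (D + 1)) (Fin (D + 1)) ℂ :=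
    Matrix.vandermonde fun j => ((j : ℕ) : ℂ)
  have hV : IsUnit V.det := by
    rw [isUnit_iff_ne_zero]
    refine Matrix.det_vandermonde_ne_zero_iff.2 fun i j h => ?_
    exact Fin.ext (by exact_mod_cast h)
  refine ⟨V⁻¹ ⟨l, by omega⟩, fun d hd => ?_⟩
  have h := congrFun (congrFun (Matrix.nonsing_inv_mul V hV) ⟨l, by omega⟩) ⟨d, by omega⟩
  rw [Matrix.mul_apply, Matrix.one_apply] at h
  simp only [Fin.mk.injEq, eq_comm (a := l)] at h
  simpa [V, Matrix.vandermonde_apply] using h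

theorem coeff_eq_sum_eval {A : Type*} [CommRing A] [Algebra ℂ A] {D l : ℕ}
    {c : Fin (D + 1) → ℂ}
    (hc : ∀ d ≤ D, ∑ j, c j * ((j : ℕ) : ℂ) ^ d = if d = l then 1 else 0) (hl : l ≤ D)
    (q : Polynomial A) (hq : q.natDegree ≤ D) :
    q.coeff l = ∑ j, algebraMap ℂ A (c j) * q.eval (algebraMap ℂ A ((j : ℕ) : ℂ)) := by
  have h1 : ∀ j : Fin (D + 1), algebraMap ℂ A (c j) * q.eval (algebraMap ℂ A ((j : ℕ) : ℂ)) =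
      ∑ d ∈ Finset.range (D + 1), algebraMap ℂ A (c j * ((j : ℕ) : ℂ) ^ d) * q.coeff d := by
    intro j
    rw [Polynomial.eval_eq_sum_range' (Nat.lt_succ_of_le hq), Finset.mul_sum]
    refine Finset.sum_congr rfl fun d _ => ?_
    rw [map_mul, map_pow]
    ring
  simp only [h1]
  rw [Finset.sum_comm]
  simp only [← Finset.sum_mul, ← map_sum]
  rw [Finset.sum_eq_single l]
  · simp [hc l hl]
  · intro d hd hne
    rw [hc d (by simpa [Nat.lt_succ_iff] using hd), if_neg hne]
    simp
  · intro h
    exact absurd (Finset.mem_range.2 (by omega)) h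

/-! ### The Schur polynomial as a small determinant -/

theorem vandermondeDet_ne_zero (n : ℕ) : vandermondeDet n ≠ 0 := by
  have h : (Matrix.of fun i j : Fin n => (X i : MvPolynomial (Fin n) ℂ) ^ (n - 1 - (j : ℕ))) =
      (Matrix.vandermonde (X : Fin n → MvPolynomial (Fin n) ℂ)).submatrix id Fin.revPerm := by
    ext1 i j
    simp only [Matrix.of_apply, Matrix.submatrix_apply, Matrix.vandermonde_apply, id,
      Fin.revPerm_apply, Fin.val_rev]
    congr 1
    omega
  rw [vandermondeDet, h, Matrix.det_permute']
  refine mul_ne_zero ?_ (Matrix.det_vandermonde_ne_zero_iff.2 (X_injective))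
  rcases Int.units_eq_one_or (Equiv.Perm.sign (Fin.revPerm : Equiv.Perm (Fin n))) with h | h <;>
    simp [h]

/-- Every `x_i` is a root of the monic polynomial `∏ (X - x_i)`, so the remainder of `X ^ m` modulo
it serves all `i` at once. -/
theorem exists_pow_eq_sum_pow (n m : ℕ) : ∃ c : Fin n → MvPolynomial (Fin n) ℂ,
    ∀ i : Fin n, (X i : MvPolynomial (Fin n) ℂ) ^ m =
      ∑ k : Fin n, X i ^ (n - 1 - (k : ℕ)) * c k := by
  set P : Polynomial (MvPolynomial (Fin n) ℂ) :=
    ∏ i : Fin n, (Polynomial.X - Polynomial.C (X i)) with hP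
  have hPm : P.Monic := Polynomial.monic_prod_of_monic _ _ fun i _ => Polynomial.monic_X_sub_C _
  have hdeg : P.natDegree = n := by
    rw [hP, Polynomial.natDegree_prod_of_monic _ _ fun i _ => Polynomial.monic_X_sub_C _]
    simp
  refine ⟨fun k => ((Polynomial.X ^ m) %ₘ P).coeff (n - 1 - (k : ℕ)), fun i => ?_⟩
  have hroot : P.eval (X i) = 0 := by
    rw [hP, Polynomial.eval_prod]
    exact Finset.prod_eq_zero (Finset.mem_univ i) (by simp)
  have h1 := congrArg (Polynomial.eval (X i : MvPolynomial (Fin n) ℂ))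
    (Polynomial.modByMonic_add_div (Polynomial.X ^ m) P)
  rw [Polynomial.eval_add, Polynomial.eval_mul, hroot, zero_mul, add_zero,
    Polynomial.eval_pow, Polynomial.eval_X] at h1
  have hn : 0 < n := i.pos
  have hlt : ((Polynomial.X ^ m) %ₘ P).natDegree < n := by
    have := Polynomial.natDegree_modByMonic_lt (Polynomial.X ^ m) hPm
      (by intro h; rw [h] at hdeg; simp at hdeg; omega)
    omega
  rw [← h1, Polynomial.eval_eq_sum_range' hlt, ← Finset.sum_range_reflect, Finset.sum_range]
  exact Finset.sum_congr rfl fun k _ => mul_comm _ _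

/-- The alternant matrix is the Vandermonde matrix times the matrix of the `c k j`. Columns beyond
`ℓ` need no reduction and are unit vectors, so the second factor is block triangular and only its
leading `ℓ × ℓ` minor counts. -/
theorem schurPoly_eq_det {ℓ : ℕ} (lam : Fin ℓ → ℕ) (n : ℕ) (hn : ℓ ≤ n)
    (c : Fin n → Fin ℓ → MvPolynomial (Fin n) ℂ)
    (hc : ∀ (i : Fin n) (j : Fin ℓ), (X i : MvPolynomial (Fin n) ℂ) ^ (lam j + (n - 1 - (j : ℕ))) =
      ∑ k : Fin n, X i ^ (n - 1 - (k : ℕ)) * c k j) :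
    schurPoly lam n = (Matrix.of fun k j : Fin ℓ => c (Fin.castLE hn k) j).det := by
  classical
  let M : Matrix (Fin n) (Fin n) (MvPolynomial (Fin n) ℂ) :=
    Matrix.of fun k j => if h : (j : ℕ) < ℓ then c k ⟨j, h⟩ else (1 : Matrix _ _ _) k j
  have hVM : vandermondeDet n * M.det = alternant lam n := by
    rw [vandermondeDet, ← Matrix.det_mul, alternant]
    congr 1
    ext1 i j
    rw [Matrix.mul_apply, Matrix.of_apply]
    by_cases h : (j : ℕ) < ℓ
    · simp only [M, Matrix.of_apply, h, dif_pos, extendByZero]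
      exact (hc i ⟨j, h⟩).symm
    · simp [M, h, extendByZero, Matrix.one_apply]
  have hM : M.det = (Matrix.of fun k j : Fin ℓ => c (Fin.castLE hn k) j).det := by
    rw [Matrix.twoBlockTriangular_det' M (fun i => (i : ℕ) < ℓ)]
    · have h2 : (M.toSquareBlockProp fun i => ¬(i : ℕ) < ℓ) = 1 := by
        ext1 i j
        simp [Matrix.toSquareBlockProp_def, M, j.2, Matrix.one_apply, Subtype.ext_iff]
      rw [h2, Matrix.det_one, mul_one]
      let e : Fin ℓ ≃ {i : Fin n // (i : ℕ) < ℓ} :=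
        { toFun := fun k => ⟨Fin.castLE hn k, k.2⟩
          invFun := fun i => ⟨i.1, i.2⟩
          left_inv := fun _ => rfl
          right_inv := fun _ => rfl }
      rw [← Matrix.det_submatrix_equiv_self e]
      congr 1
      ext1 k j
      simp [Matrix.toSquareBlockProp_def, M, e]
    · intro i hi j hj
      have : i ≠ j := by rintro rfl; exact hj hi
      simp [M, hj, this]
  rw [← hM]
  exact mul_left_cancel₀ (vandermondeDet_ne_zero n)
    ((vandermondeDet_mul_schurPoly lam n).trans hVM.symm)

/-! ### Expansion at the roots of unity -/

theorem Polynomial.coeff_one_linear_pow {A : Type*} [CommRing A] (a b : A) (m : ℕ) :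
    ((Polynomial.C a + Polynomial.X * Polynomial.C b) ^ m).coeff 1 = m * a ^ (m - 1) * b := by
  have h := Polynomial.coeff_derivative
    ((Polynomial.C a + Polynomial.X * Polynomial.C b) ^ m) 0
  rw [Polynomial.derivative_pow] at h
  simp only [Polynomial.coeff_zero_eq_eval_zero] at h
  simpa using h.symm

theorem Polynomial.coeff_zero_linear_pow {A : Type*} [CommRing A] (a b : A) (m : ℕ) :
    ((Polynomial.C a + Polynomial.X * Polynomial.C b) ^ m).coeff 0 = a ^ m := by
  simp [Polynomial.coeff_zero_eq_eval_zero]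

/-- Each entry is divisible by `X`; pull `X ^ l` out of the determinant and evaluate the rest at
`0`. -/
theorem Matrix.coeff_det_of_coeff_zero {A : Type*} [CommRing A] {l : ℕ}
    (M : Matrix (Fin l) (Fin l) (Polynomial A)) (h : ∀ i j, (M i j).coeff 0 = 0) :
    M.det.coeff l = (Matrix.of fun i j => (M i j).coeff 1).det := by
  have hM : M = (Polynomial.X : Polynomial A) • Matrix.of fun i j => (M i j).divX := by
    ext1 i j
    have := Polynomial.divX_mul_X_add (M i j)
    rw [h, map_zero, add_zero, mul_comm] at this
    simpa using this.symm
  conv_lhs => rw [hM]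
  rw [Matrix.det_smul, Fintype.card_fin]
  have h0 := Polynomial.coeff_X_pow_mul (Matrix.of fun i j => (M i j).divX).det l 0
  rw [zero_add] at h0
  rw [h0, Polynomial.coeff_zero_eq_eval_zero, ← Polynomial.coe_evalRingHom, RingHom.map_det]
  congr 1
  ext1 i j
  simp [← Polynomial.coeff_zero_eq_eval_zero, Polynomial.coeff_divX]

/-- Orthogonality of the powers of a primitive root of unity. -/
theorem IsPrimitiveRoot.sum_pow_mul {A : Type*} [CommRing A] [IsDomain A] {ζ : A} {n : ℕ}
    (hζ : IsPrimitiveRoot ζ n) (e : ℕ) :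
    ∑ i : Fin n, (ζ ^ (i : ℕ)) ^ e = if n ∣ e then (n : A) else 0 := by
  split_ifs with h
  · obtain ⟨q, rfl⟩ := h
    simp [← pow_mul, mul_left_comm _ n, pow_mul ζ n, hζ.pow_eq_one]
  · have h1 : ζ ^ e ≠ 1 := fun h1 => h ((hζ.pow_eq_one_iff_dvd e).1 h1)
    have h2 := Finset.sum_range (n := n) fun i => (ζ ^ e) ^ i
    simp only [← pow_mul, mul_comm _ e]
    simp only [← pow_mul] at h2
    rw [← h2]
    simp only [pow_mul]
    refine eq_zero_of_ne_zero_of_mul_left_eq_zero (sub_ne_zero_of_ne h1.symm) ?_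
    rw [mul_neg_geom_sum, ← pow_mul, mul_comm, pow_mul, hζ.pow_eq_one, one_pow, sub_self]

/-- Fourier inversion: after multiplication by `ζ ^ (i (k + 1))`, the exponent `n + k - k'` lies
strictly between `0` and `2n`, so only `k' = k` survives the sum over `i`. -/
theorem IsPrimitiveRoot.eq_sum_of_sum_pow {A : Type*} [CommRing A] [IsDomain A] {ζ : A} {n : ℕ}
    (hζ : IsPrimitiveRoot ζ n) (u g : Fin n → A)
    (h : ∀ i : Fin n, ∑ k : Fin n, (ζ ^ (i : ℕ)) ^ (n - 1 - (k : ℕ)) * u k = g i) (k : Fin n) :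
    (n : A) * u k = ∑ i : Fin n, (ζ ^ (i : ℕ)) ^ ((k : ℕ) + 1) * g i := by
  simp only [← h, Finset.mul_sum]
  rw [Finset.sum_comm]
  simp only [← mul_assoc, ← pow_add, ← Finset.sum_mul, hζ.sum_pow_mul]
  rw [Finset.sum_eq_single k]
  · rw [if_pos]
    have := k.2
    exact ⟨1, by omega⟩
  · intro k' _ hne
    rw [if_neg, zero_mul]
    rintro ⟨q, hq⟩
    have h1 := k.2
    have h2 := k'.2
    have h3 : (k' : ℕ) ≠ k := fun h => hne (Fin.ext h)
    rcases q with _ | _ | q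
    · omega
    · omega
    · have : n * (q + 1 + 1) = n * q + n + n := by ring
      have := Nat.zero_le (n * q)
      omega
  · simp

/-- First-order expansion, around the roots of unity `ζ ^ i`, of the coefficients `u k` which
express the powers `x_i ^ (n + r)` through the lower powers. -/
theorem coeff_of_linear_pow_eq_sum {A : Type*} [CommRing A] [IsDomain A] [CharZero A] {ζ : A}
    {n r : ℕ} (hζ : IsPrimitiveRoot ζ n) (hr : r < n) (b : Fin n → A) (u : Fin n → Polynomial A)
    (h : ∀ i : Fin n,
      (Polynomial.C (ζ ^ (i : ℕ)) + Polynomial.X * Polynomial.C (b i)) ^ (n + r) =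
      ∑ k : Fin n,
        (Polynomial.C (ζ ^ (i : ℕ)) + Polynomial.X * Polynomial.C (b i)) ^ (n - 1 - (k : ℕ)) * u k) (k : Fin n) :
    ((u k).coeff 0 = if (k : ℕ) + r + 1 = n then 1 else 0) ∧
      (u k).coeff 1 = ∑ i : Fin n, (ζ ^ (i : ℕ)) ^ ((k : ℕ) + r) * b i := by
  have hn : n ≠ 0 := by omega
  have hn' : (n : A) ≠ 0 := Nat.cast_ne_zero.2 hn
  have hroot : ∀ i : Fin n, (ζ ^ (i : ℕ)) ^ n = 1 := fun i => by
    rw [← pow_mul, mul_comm, pow_mul, hζ.pow_eq_one, one_pow]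
  have h0 : ∀ k : Fin n, (u k).coeff 0 = if (k : ℕ) + r + 1 = n then 1 else 0 := by
    intro k
    have := hζ.eq_sum_of_sum_pow (fun k => (u k).coeff 0)
      (fun i => (ζ ^ (i : ℕ)) ^ (n + r)) (fun i => by
        have := congrArg (fun q => Polynomial.coeff q 0) (h i)
        simp only [Polynomial.coeff_zero_linear_pow, Polynomial.finsetSum_coeff,
          Polynomial.mul_coeff_zero] at this
        exact this.symm) k
    simp only [← pow_add, hζ.sum_pow_mul] at this
    apply mul_left_cancel₀ hn'
    rw [this]
    have hk := k.2
    -- The left-hand number lies strictly between `n` and `3n`, so `2n` is the only possible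
    -- multiple.
    have hiff : n ∣ (k : ℕ) + 1 + (n + r) ↔ (k : ℕ) + r + 1 = n := by
      constructor
      · rintro ⟨q, hq⟩
        rcases q with _ | _ | _ | q
        · omega
        · omega
        · omega
        · have : n * (q + 1 + 1 + 1) = n * q + n + n + n := by ring
          have := Nat.zero_le (n * q)
          omega
      · intro h
        exact ⟨2, by omega⟩
    simp [hiff]
  refine ⟨h0 k, ?_⟩
  -- Differentiating at `t = 0`, the left side gives `(n + r) ζ^(i (n + r - 1)) b_i`, while the
  -- moving lower powers contribute `r ζ^(i (r - 1)) b_i`. As `ζ^n = 1`, the difference is `n ζ^(i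
  -- (n + r - 1)) b_i`; its factor `n` cancels the one from the inversion.
  have h1 := hζ.eq_sum_of_sum_pow (fun k => (u k).coeff 1)
    (fun i => n * (ζ ^ (i : ℕ)) ^ (n + r - 1) * b i) (fun i => by
      have := congrArg (fun q => Polynomial.coeff q 1) (h i)
      simp only [Polynomial.coeff_one_linear_pow, Polynomial.finsetSum_coeff,
        Polynomial.mul_coeff_one, Polynomial.coeff_zero_linear_pow, h0] at this
      have h2 : ∑ k : Fin n, ((n - 1 - (k : ℕ) : ℕ) : A) * (ζ ^ (i : ℕ)) ^ (n - 1 - (k : ℕ) - 1) *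
          b i * (if (k : ℕ) + r + 1 = n then 1 else 0) = r * (ζ ^ (i : ℕ)) ^ (r - 1) * b i := by
        rw [Finset.sum_eq_single (⟨n - 1 - r, by omega⟩ : Fin n)]
        · rw [if_pos (by simp only; omega), mul_one]
          simp only [show n - 1 - (n - 1 - r) = r by omega]
        · intro k _ hk
          rw [if_neg, mul_zero]
          intro h'
          exact hk (Fin.ext (by simp only; omega))
        · simp
      have h3 : (r : A) * (ζ ^ (i : ℕ)) ^ (r - 1) = r * (ζ ^ (i : ℕ)) ^ (n + r - 1) := by
        rcases Nat.eq_zero_or_pos r with rfl | hr0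
        · simp
        · rw [Nat.add_sub_assoc hr0, pow_add, hroot, one_mul]
      rw [Finset.sum_add_distrib, h2, h3, Nat.cast_add] at this
      linear_combination -this) k
  apply mul_left_cancel₀ hn'
  rw [h1, Finset.mul_sum]
  refine Finset.sum_congr rfl fun i _ => ?_
  have : (ζ ^ (i : ℕ)) ^ ((k : ℕ) + 1) * (ζ ^ (i : ℕ)) ^ (n + r - 1) =
      (ζ ^ (i : ℕ)) ^ ((k : ℕ) + r) := by
    rw [← pow_add, show (k : ℕ) + 1 + (n + r - 1) = n + (k + r) by omega, pow_add, hroot, one_mul]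
  rw [← this]
  ring

/-! ### The determinant as a coefficient of a Schur polynomial -/

namespace WellSpaced

variable {ℓ : ℕ} {lam : Fin ℓ → ℕ} {n : ℕ}

/-- A gap of `ℓ - 1`, plus one from the shift of the index, separates the numbers `λ_i - i` by at
least `ℓ`. This keeps the frequency blocks `λ_j - 1 - j + [0, ℓ)` disjoint. -/
theorem add_le_of_lt (h : WellSpaced lam n) (i j : Fin ℓ) (hij : i < j) :
    lam j + i + ℓ ≤ lam i + j := by
  obtain ⟨j, hj⟩ := j
  induction j with
  | zero => exact absurd (Fin.lt_def.1 hij) (Nat.not_lt_zero _)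
  | succ j ih =>
    have h1 := h.gap ⟨j, by omega⟩ ⟨j + 1, hj⟩ rfl
    rcases Nat.lt_succ_iff_lt_or_eq.1 (Fin.lt_def.1 hij) with h2 | h2
    · have := ih (by omega) (Fin.lt_def.2 h2)
      simp only at this ⊢
      omega
    · have : i = ⟨j, by omega⟩ := Fin.ext h2
      rw [this]
      simp only
      omega

theorem length_le (h : WellSpaced lam n) (i : Fin ℓ) : ℓ ≤ lam i := by
  have hl := h.length_pos
  have h1 := h.last_ge ⟨ℓ - 1, by omega⟩ (by simp only; omega)
  rcases Nat.lt_or_ge i (ℓ - 1) with h2 | h2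
  · have := h.add_le_of_lt i ⟨ℓ - 1, by omega⟩ (Fin.lt_def.2 h2)
    simp only at this
    omega
  · have : i = ⟨ℓ - 1, by omega⟩ := Fin.ext (by have := i.2; simp only; omega)
    rwa [this]

theorem add_length_le (h : WellSpaced lam n) (i : Fin ℓ) : lam i + ℓ ≤ n + i := by
  have h1 := h.first_le ⟨0, h.length_pos⟩ rfl
  rcases Nat.eq_zero_or_pos i with h2 | h2
  · have : i = ⟨0, h.length_pos⟩ := Fin.ext h2
    rw [this]
    simpa using h1
  · have := h.add_le_of_lt ⟨0, h.length_pos⟩ i (Fin.lt_def.2 h2)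
    simp only at this
    omega

theorem length_le_vars (h : WellSpaced lam n) : ℓ ≤ n := by
  have := h.first_le ⟨0, h.length_pos⟩ rfl
  omega

/-- The indices of the entries in the Jacobi–Trudi matrix are distinct. -/
theorem index_injective (h : WellSpaced lam n) (k k' j j' : Fin ℓ)
    (e : (k : ℕ) + (lam j - 1 - j) = k' + (lam j' - 1 - j')) : k = k' ∧ j = j' := by
  have h1 := h.length_le j
  have h2 := h.length_le j'
  have := k.2
  have := k'.2
  have := j.2
  have := j'.2
  rcases lt_trichotomy j j' with hj | rfl | hj
  · have := h.add_le_of_lt j j' hj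
    omega
  · exact ⟨Fin.ext (by omega), rfl⟩
  · have := h.add_le_of_lt j' j hj
    omega

/-- The heart of the argument: near the roots of unity, the lowest-order term of the Jacobi–Trudi
determinant is a determinant of independent variables. -/
theorem exists_coeff_aeval_schurPoly_eq_det (h : WellSpaced lam n) :
    ∃ (a : Fin n → ℂ) (b : Fin n → Fin ℓ × Fin ℓ → ℂ),
      (aeval (fun i => Polynomial.C (C (a i)) + Polynomial.X * Polynomial.C (∑ p, C (b i p) * X p))
        (schurPoly lam n) : Polynomial (MvPolynomial (Fin ℓ × Fin ℓ) ℂ)).coeff ℓ =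
      (Matrix.mvPolynomialX (Fin ℓ) (Fin ℓ) ℂ).det := by
  have hl := h.length_pos
  have hln := h.length_le_vars
  have hn : n ≠ 0 := by omega
  have hnC : (n : ℂ) ≠ 0 := Nat.cast_ne_zero.2 hn
  obtain ⟨ζ, hζ⟩ : ∃ ζ : ℂ, IsPrimitiveRoot ζ n := ⟨_, Complex.isPrimitiveRoot_exp n hn⟩
  let r : Fin ℓ → ℕ := fun j => lam j - 1 - j
  -- Inverse Fourier coefficients `ζ^(-i (k + r_j)) / n`; the exponent is shifted by `n` to stay in
  -- `ℕ`, where `k + r_j < n`.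
  let b : Fin n → Fin ℓ × Fin ℓ → ℂ := fun i p =>
    (n : ℂ)⁻¹ * (ζ ^ (i : ℕ)) ^ (n - ((p.1 : ℕ) + r p.2))
  refine ⟨fun i => ζ ^ (i : ℕ), b, ?_⟩
  choose c hc using fun j : Fin ℓ => exists_pow_eq_sum_pow n (lam j + (n - 1 - (j : ℕ)))
  rw [schurPoly_eq_det lam n hln (fun k j => c j k) (fun i j => hc j i)]
  set x : Fin n → Polynomial (MvPolynomial (Fin ℓ × Fin ℓ) ℂ) := fun i =>
    Polynomial.C (C (ζ ^ (i : ℕ))) + Polynomial.X * Polynomial.C (∑ p, C (b i p) * X p) with hx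
  have hζ' : IsPrimitiveRoot (C ζ : MvPolynomial (Fin ℓ × Fin ℓ) ℂ) n :=
    hζ.map_of_injective (C_injective _ _)
  have key : ∀ (j k : Fin ℓ), (aeval x (c j (Fin.castLE hln k))).coeff 0 = 0 ∧
      (aeval x (c j (Fin.castLE hln k))).coeff 1 = X (k, j) := by
    intro j k
    have hj := j.2
    have hk := k.2
    have h1 := h.length_le j
    have h2 := h.add_length_le j
    obtain ⟨e0, e1⟩ := coeff_of_linear_pow_eq_sum (r := r j) hζ' (by simp only [r]; omega)
      (fun i => ∑ p, C (b i p) * X p) (fun k => aeval x (c j k)) (fun i => by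
        have := congrArg (aeval x) (hc j i)
        simp only [map_pow, map_sum, map_mul, aeval_X] at this
        rw [show lam j + (n - 1 - (j : ℕ)) = n + r j by have := i.2; simp only [r]; omega] at this
        simpa only [hx, map_pow, map_sum, map_mul] using this) (Fin.castLE hln k)
    -- From `λ_j + ℓ ≤ n + j` and `k < ℓ` follows `k + r_j + 1 < n`, so the constant term vanishes.
    rw [if_neg (by simp only [r, Fin.val_castLE]; omega)] at e0
    refine ⟨e0, e1.trans ?_⟩
    simp only [Finset.mul_sum, Fin.val_castLE]
    rw [Finset.sum_comm, Finset.sum_eq_single (k, j)]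
    · have h3 : ∀ i : Fin n, (ζ ^ (i : ℕ)) ^ ((k : ℕ) + r j) * b i (k, j) = (n : ℂ)⁻¹ := by
        intro i
        simp only [b]
        rw [mul_left_comm, ← pow_add, show (k : ℕ) + r j + (n - (k + r j)) = n by
          simp only [r]; omega, ← pow_mul, mul_comm _ n, pow_mul, hζ.pow_eq_one, one_pow, mul_one]
      simp only [← mul_assoc, ← map_pow, ← map_mul, h3]
      rw [Finset.sum_const, Finset.card_univ, Fintype.card_fin, nsmul_eq_mul, ← mul_assoc,
        ← map_natCast (C : ℂ →+* MvPolynomial (Fin ℓ × Fin ℓ) ℂ), ← map_mul,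
        mul_inv_cancel₀ hnC, map_one, one_mul]
    · rintro ⟨k', j'⟩ - hne
      simp only [← mul_assoc, ← map_pow, ← map_mul, b, ← Finset.sum_mul, ← map_sum]
      simp only [mul_comm _ (n : ℂ)⁻¹, mul_assoc, ← pow_add, ← Finset.mul_sum, hζ.sum_pow_mul]
      rw [if_neg, mul_zero, map_zero, zero_mul]
      rintro ⟨q, hq⟩
      have h1' := h.length_le j'
      have h2' := h.add_length_le j'
      have hj' := j'.2
      have hk' := k'.2
      have h4 : (k : ℕ) + r j ≠ k' + r j' := fun e => by
        obtain ⟨rfl, rfl⟩ := h.index_injective k k' j j' e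
        exact hne rfl
      simp only [r] at hq h4
      rcases q with _ | _ | q
      · omega
      · omega
      · have : n * (q + 1 + 1) = n * q + n + n := by ring
        have := Nat.zero_le (n * q)
        omega
    · simp
  rw [AlgHom.map_det, Matrix.coeff_det_of_coeff_zero]
  · congr 1
    ext1 k j
    simpa using (key j k).2
  · intro k j
    simpa using (key j k).1

end WellSpaced

/-! ### Formulas of Schur polynomials give formulas of determinants -/

theorem natDegree_aeval_le_totalDegree {σ : Type*} {A : Type*} [CommRing A] [Algebra ℂ A]
    (x : σ → Polynomial A) (hx : ∀ i, (x i).natDegree ≤ 1) (p : MvPolynomial σ ℂ) :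
    (aeval x p).natDegree ≤ p.totalDegree := by
  rw [aeval_def, eval₂_eq]
  refine Polynomial.natDegree_sum_le_of_forall_le _ _ fun d hd => ?_
  rw [IsScalarTower.algebraMap_apply ℂ A (Polynomial A), Polynomial.algebraMap_eq]
  refine (Polynomial.natDegree_C_mul_le _ _).trans ((Polynomial.natDegree_prod_le _ _).trans ?_)
  refine (Finset.sum_le_sum fun i _ => ?_).trans (le_totalDegree hd)
  exact (Polynomial.natDegree_pow_le_of_le (d i) (hx i)).trans (by simp)

/-- The size of the determinant formula extracted from a formula of a Schur polynomial. -/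
def detFormulaSize : Polynomial ℕ :=
  1 + (Polynomial.X + 1) * (Polynomial.X * (Polynomial.X ^ 2 + 2))

/-- At each node `t = 0, …, s` the variables become affine forms of size `ℓ² + 2` and depth `1`; a
weighted sum of these `s + 1` formulas isolates the coefficient of `t^ℓ`. -/
theorem hasFormula_det_of_hasFormula_schurPoly {ℓ : ℕ} {lam : Fin ℓ → ℕ} {n : ℕ}
    (h : WellSpaced lam n) {s d : ℕ} (hF : HasFormula (schurPoly lam n) s d) :
    HasFormula (Matrix.mvPolynomialX (Fin ℓ) (Fin ℓ) ℂ).det (detFormulaSize.eval s) (d + 2) := by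
  obtain ⟨a, b, hab⟩ := h.exists_coeff_aeval_schurPoly_eq_det
  set x : Fin n → Polynomial (MvPolynomial (Fin ℓ × Fin ℓ) ℂ) := fun i =>
    Polynomial.C (C (a i)) + Polynomial.X * Polynomial.C (∑ p, C (b i p) * X p) with hx
  have hdeg : (aeval x (schurPoly lam n)).natDegree ≤ s := by
    refine (natDegree_aeval_le_totalDegree x (fun i => ?_) _).trans hF.totalDegree_le
    simp only [hx]
    compute_degree
  -- Otherwise the coefficient of `t^ℓ` would vanish for degree reasons, but the determinant is
  -- nonzero. This also bounds `ℓ²` in terms of `s`.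
  have hls : ℓ ≤ s := by
    by_contra hlt
    rw [Polynomial.coeff_eq_zero_of_natDegree_lt (by omega)] at hab
    exact Matrix.det_mvPolynomialX_ne_zero (Fin ℓ) ℂ hab.symm
  obtain ⟨c, hc⟩ := exists_interpolation_weights s ℓ hls
  rw [← hab, coeff_eq_sum_eval hc hls _ hdeg]
  have hterm : ∀ j : Fin (s + 1),
      HasFormula ((aeval x (schurPoly lam n)).eval
        (algebraMap ℂ (MvPolynomial (Fin ℓ × Fin ℓ) ℂ) ((j : ℕ) : ℂ)))
        (s * (ℓ ^ 2 + 2)) (d + 1) := by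
    intro j
    have h1 := comp_aeval_apply (σ := Fin n) (R := ℂ) (f := x)
      ((Polynomial.aeval (algebraMap ℂ (MvPolynomial (Fin ℓ × Fin ℓ) ℂ) ((j : ℕ) : ℂ))
        ).restrictScalars ℂ : Polynomial (MvPolynomial (Fin ℓ × Fin ℓ) ℂ) →ₐ[ℂ] MvPolynomial (Fin ℓ × Fin ℓ) ℂ)
      (schurPoly lam n)
    simp only [AlgHom.restrictScalars_apply, Polynomial.coe_aeval_eq_eval] at h1
    rw [h1]
    refine hF.aeval _ (by omega) fun i => ?_
    have h2 := hasFormula_affine (τ := Fin ℓ × Fin ℓ) (a i) (fun p => (j : ℕ) * b i p)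
    simp only [Fintype.card_prod, Fintype.card_fin, ← pow_two] at h2
    convert h2 using 1
    simp [hx, Polynomial.eval_finsetSum, Finset.mul_sum, mul_assoc]
  refine (HasFormula.sum c hterm).mono ?_ (by omega)
  simp only [detFormulaSize, Fintype.card_fin, Polynomial.eval_add, Polynomial.eval_mul,
    Polynomial.eval_one, Polynomial.eval_X, Polynomial.eval_pow, Polynomial.eval_ofNat]
  gcongr

/-! ### Branching programs and determinants -/

/-- A family of values that satisfies the recursion of a branching program computes its path
sums. -/
theorem sum_mul_eq_sum_paths {A : Type*} [CommRing A] (n : ℕ) (w : Fin (n + 1) → ℕ)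
    (label : ∀ i : Fin n, Fin (w i.castSucc) → Fin (w i.succ) → A) (v : ∀ i, Fin (w i) → A)
    (hlast : ∀ u, v (Fin.last n) u = 1)
    (hstep : ∀ i u, v (Fin.castSucc i) u = ∑ u', label i u u' * v i.succ u')
    (c : Fin (w 0) → A) :
    ∑ u, c u * v 0 u = ∑ path : (∀ i, Fin (w i)),
      c (path 0) * ∏ i : Fin n, label i (path i.castSucc) (path i.succ) := by
  induction n with
  | zero =>
    rw [← (Fin.consEquiv fun i => Fin (w i)).sum_comp, Fintype.sum_prod_type]
    refine Finset.sum_congr rfl fun u _ => ?_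
    have h1 : v 0 u = 1 := hlast u
    simp [h1, Fin.consEquiv]
  | succ n ih =>
    have h := ih (fun i => w i.succ) (fun i => label i.succ) (fun i => v i.succ) hlast
      (fun i u => hstep i.succ u) (fun u' => ∑ u, c u * label 0 u u')
    rw [← (Fin.consEquiv fun i => Fin (w i)).sum_comp, Fintype.sum_prod_type, Finset.sum_comm]
    calc ∑ u, c u * v 0 u = ∑ u, ∑ u', c u * label 0 u u' * v (Fin.succ 0) u' := by
          refine Finset.sum_congr rfl fun u _ => ?_
          have h0 : v 0 u = ∑ u', label 0 u u' * v (Fin.succ 0) u' := hstep 0 u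
          rw [h0, Finset.mul_sum]
          exact Finset.sum_congr rfl fun u' _ => (mul_assoc _ _ _).symm
      _ = ∑ u', (∑ u, c u * label 0 u u') * v (Fin.succ 0) u' := by
          rw [Finset.sum_comm]
          simp only [Finset.sum_mul]
      _ = _ := h.trans ?_
    refine Finset.sum_congr rfl fun path _ => ?_
    rw [Finset.sum_mul]
    refine Finset.sum_congr rfl fun u _ => ?_
    rw [Fin.prod_univ_succ, ← mul_assoc]
    rfl

namespace ABP

variable {σ : Type} (B : ABP σ)

/-- The vertices of a branching program. -/
abbrev Vertex : Type := Σ i : Fin (B.len + 1), Fin (B.width i)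

theorem card_vertex : Fintype.card B.Vertex = B.size := by
  simp [size]

/-- The weighted adjacency matrix. -/
def adjacency : Matrix B.Vertex B.Vertex (MvPolynomial σ ℂ) :=
  Matrix.of fun p q => ∑ i : Fin B.len, ∑ u, ∑ u',
    if p = ⟨i.castSucc, u⟩ ∧ q = ⟨i.succ, u'⟩ then B.label i u u' else 0

theorem totalDegree_adjacency_le (p q : B.Vertex) : (B.adjacency p q).totalDegree ≤ 1 := by
  rw [adjacency, Matrix.of_apply]
  refine totalDegree_finsetSum_le fun i _ => totalDegree_finsetSum_le fun u _ =>
    totalDegree_finsetSum_le fun u' _ => ?_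
  split_ifs
  · exact B.label_linear i u u'
  · simp

theorem adjacency_eq_zero (p q : B.Vertex) (h : q.1 ≤ p.1) : B.adjacency p q = 0 := by
  rw [adjacency, Matrix.of_apply]
  refine Finset.sum_eq_zero fun i _ => Finset.sum_eq_zero fun u _ =>
    Finset.sum_eq_zero fun u' _ => if_neg ?_
  rintro ⟨rfl, rfl⟩
  exact absurd h (not_le.2 (Fin.castSucc_lt_succ))

theorem adjacency_mulVec (v : B.Vertex → MvPolynomial σ ℂ) (i : Fin B.len)
    (u : Fin (B.width i.castSucc)) :
    (B.adjacency.mulVec v) ⟨i.castSucc, u⟩ = ∑ u', B.label i u u' * v ⟨i.succ, u'⟩ := by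
  classical
  have h : ∀ (i' : Fin B.len) (w : Fin (B.width i'.castSucc)),
      (⟨i.castSucc, u⟩ : B.Vertex) = ⟨i'.castSucc, w⟩ ↔
        (⟨i, u⟩ : Σ i : Fin B.len, Fin (B.width i.castSucc)) = ⟨i', w⟩ := by
    intro i' w
    constructor
    · intro h
      obtain ⟨h1, h2⟩ := Sigma.mk.inj h
      have := Fin.castSucc_injective _ h1
      subst this
      rw [eq_of_heq h2]
    · intro h
      obtain ⟨rfl, h2⟩ := Sigma.mk.inj h
      rw [eq_of_heq h2]
  simp only [Matrix.mulVec, dotProduct, adjacency, Matrix.of_apply, Finset.sum_mul, ite_mul,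
    zero_mul]
  rw [Finset.sum_comm]
  rw [Finset.sum_eq_single i]
  · rw [Finset.sum_comm, Finset.sum_eq_single u]
    · rw [Finset.sum_comm]
      simp
    · intro w _ hw
      have : u ≠ w := hw.symm
      simp [this]
    · simp
  · intro i' _ hi'
    refine Finset.sum_eq_zero fun q _ => Finset.sum_eq_zero fun w _ =>
      Finset.sum_eq_zero fun w' _ => if_neg ?_
    rintro ⟨h1, -⟩
    exact hi' (Sigma.mk.inj ((h i' w).1 h1)).1.symm
  · simp

/-- Edges lead to later layers, so the matrix is block triangular along the layers with identity
diagonal blocks. -/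
theorem det_one_sub_adjacency : (1 - B.adjacency).det = 1 := by
  classical
  have h : (1 - B.adjacency).BlockTriangular (fun p : B.Vertex => p.1) := by
    intro p q hpq
    have hne : p ≠ q := by
      rintro rfl
      exact lt_irrefl _ hpq
    simp [hne, B.adjacency_eq_zero p q (le_of_lt hpq)]
  rw [h.det_fintype]
  refine Finset.prod_eq_one fun k _ => ?_
  rw [← Matrix.det_one (n := {p : B.Vertex // p.1 = k})]
  congr 1
  ext1 p q
  have : B.adjacency p q = 0 := B.adjacency_eq_zero _ _ (le_of_eq (q.2.trans p.2.symm))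
  simp [Matrix.toSquareBlock_def, this, Matrix.one_apply, Subtype.ext_iff]

/-- The source. -/
def source : B.Vertex := ⟨0, ⟨0, by rw [B.width_source]; exact Nat.one_pos⟩⟩

/-- The sink. -/
def sink : B.Vertex := ⟨Fin.last B.len, ⟨0, by rw [B.width_sink]; exact Nat.one_pos⟩⟩

theorem eval_eq_of_recursion (v : ∀ i, Fin (B.width i) → MvPolynomial σ ℂ)
    (hlast : ∀ u, v (Fin.last B.len) u = 1)
    (hstep : ∀ i u, v (Fin.castSucc i) u = ∑ u', B.label i u u' * v i.succ u')
    (u : Fin (B.width 0)) : B.eval = v 0 u := by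
  have h := sum_mul_eq_sum_paths B.len B.width B.label v hlast hstep (fun _ => 1)
  have hsub : ∀ u', u' = u := by
    intro u'
    have h0 := B.width_source
    exact Fin.ext (by omega)
  rw [Fintype.sum_eq_single u fun u' hu' => absurd (hsub u') hu'] at h
  simp only [one_mul] at h
  exact h.symm

/-- The matrix whose determinant is the polynomial computed by a branching program. -/
def detMatrix : Matrix B.Vertex B.Vertex (MvPolynomial σ ℂ) :=
  (1 - B.adjacency).updateRow B.sink (Pi.single B.source 1)

theorem totalDegree_detMatrix_le (p q : B.Vertex) : (B.detMatrix p q).totalDegree ≤ 1 := by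
  classical
  simp only [detMatrix, Matrix.updateRow_apply]
  split_ifs
  · rw [Pi.single_apply]
    split_ifs <;> simp
  · rw [Matrix.sub_apply, Matrix.one_apply]
    refine (totalDegree_sub _ _).trans (max_le ?_ (B.totalDegree_adjacency_le p q))
    split_ifs <;> simp

/-- The solution of `(1 - A) v = e_sink` satisfies the recursion for path sums to the sink; by
Cramer's rule its entry at the source is this determinant. -/
theorem det_detMatrix : B.detMatrix.det = B.eval := by
  have hv : (1 - B.adjacency).mulVec ((1 - B.adjacency).adjugate.mulVec (Pi.single B.sink 1)) =
      Pi.single B.sink 1 := by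
    rw [Matrix.mulVec_mulVec, Matrix.mul_adjugate]
    rw [B.det_one_sub_adjacency, one_smul, Matrix.one_mulVec]
  set v := (1 - B.adjacency).adjugate.mulVec (Pi.single B.sink 1) with hvdef
  rw [Matrix.sub_mulVec, Matrix.one_mulVec] at hv
  have hs : v B.source = B.detMatrix.det := by
    rw [hvdef, Matrix.mulVec_single_one, Matrix.col_apply, Matrix.adjugate_apply]
    rfl
  rw [B.eval_eq_of_recursion (fun i u => v ⟨i, u⟩) ?_ ?_ B.source.2, ← hs]
  · rfl
  · intro u
    have hu : (⟨Fin.last B.len, u⟩ : B.Vertex) = B.sink := by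
      have h1 := B.width_sink
      simp only [sink]
      congr 1
      exact Fin.ext (by simp only; omega)
    have h1 := congrFun hv ⟨Fin.last B.len, u⟩
    have h2 : B.adjacency.mulVec v ⟨Fin.last B.len, u⟩ = 0 :=
      Finset.sum_eq_zero fun q _ => by
        simp only
        rw [B.adjacency_eq_zero _ _ (Fin.le_last _), zero_mul]
    rw [Pi.sub_apply, h2, sub_zero, hu, Pi.single_eq_same, ← hu] at h1
    exact h1
  · intro i u
    have h1 := congrFun hv ⟨i.castSucc, u⟩
    rw [Pi.sub_apply, adjacency_mulVec, Pi.single_eq_of_ne, sub_eq_zero] at h1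
    · exact h1
    · intro h
      exact absurd (Sigma.mk.inj h).1 (Fin.castSucc_lt_last i).ne

end ABP

theorem aeval_det_mvPolynomialX {R S m : Type*} [Fintype m] [DecidableEq m] [CommRing R]
    [CommRing S] [Algebra R S] (M : Matrix m m S) :
    aeval (fun p : m × m => M p.1 p.2) (Matrix.mvPolynomialX m m R).det = M.det := by
  rw [AlgHom.map_det, Matrix.mvPolynomialX_mapMatrix_aeval]

/-- Pad the matrix with an identity block to order `L` and substitute its entries, which are affine,
into the symbolic determinant. -/
theorem hasFormula_det_of_le {σ V : Type} [Fintype σ] [Fintype V] [DecidableEq V] {L s d : ℕ}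
    (hF : HasFormula (Matrix.mvPolynomialX (Fin L) (Fin L) ℂ).det s d) (hL : Fintype.card V ≤ L)
    (M : Matrix V V (MvPolynomial σ ℂ)) (hM : ∀ p q, (M p q).totalDegree ≤ 1) :
    HasFormula M.det (s * (Fintype.card σ + 2)) (d + 1) := by
  let e : Fin L ≃ V ⊕ Fin (L - Fintype.card V) :=
    Fintype.equivOfCardEq (by simp; omega)
  let N : Matrix (Fin L) (Fin L) (MvPolynomial σ ℂ) := (Matrix.fromBlocks M 0 0 1).submatrix e e
  have hN : N.det = M.det := by
    rw [Matrix.det_submatrix_equiv_self, Matrix.det_fromBlocks_zero₂₁, Matrix.det_one, mul_one]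
  rw [← hN, ← aeval_det_mvPolynomialX (R := ℂ)]
  refine hF.aeval _ (by omega) fun p => hasFormula_of_totalDegree_le_one _ ?_
  simp only [N, Matrix.submatrix_apply]
  rcases e p.1 with a | a <;> rcases e p.2 with b | b
  · simpa using hM a b
  · simp
  · simp
  · simp only [Matrix.fromBlocks_apply₂₂, Matrix.one_apply]
    split_ifs <;> simp

theorem ABP.hasFormula_eval {σ : Type} [Fintype σ] (B : ABP σ) {L s d : ℕ}
    (hF : HasFormula (Matrix.mvPolynomialX (Fin L) (Fin L) ℂ).det s d) (hL : B.size ≤ L) :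
    HasFormula B.eval (s * (Fintype.card σ + 2)) (d + 1) := by
  rw [← B.det_detMatrix]
  exact hasFormula_det_of_le hF (B.card_vertex.trans_le hL) _ B.totalDegree_detMatrix_le

/-! ### From formulas to branching programs -/

/-- `AffineProgram N S`: the polynomials in `S` are obtained in `N` steps, starting from `1`, each
step forming a combination of earlier polynomials with coefficients of degree at most one. -/
inductive AffineProgram {σ : Type} : ℕ → Set (MvPolynomial σ ℂ) → Prop
  | one : AffineProgram 1 {1}
  | step {N : ℕ} {S : Set (MvPolynomial σ ℂ)} (hS : AffineProgram N S) {m : ℕ}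
      (a h : Fin m → MvPolynomial σ ℂ) (ha : ∀ i, (a i).totalDegree ≤ 1) (hh : ∀ i, h i ∈ S) :
      AffineProgram (N + 1) (insert (∑ i, a i * h i) S)

namespace AffineProgram

variable {σ : Type}

theorem exists_mul_of_totalDegree_le_one {N : ℕ} {S : Set (MvPolynomial σ ℂ)}
    (hS : AffineProgram N S) {g p : MvPolynomial σ ℂ} (hg : g ∈ S) (hp : p.totalDegree ≤ 1) :
    ∃ S', AffineProgram (N + 1) S' ∧ S ⊆ S' ∧ g * p ∈ S' := by
  have h := hS.step (m := 1) (fun _ => p) (fun _ => g) (fun _ => hp) (fun _ => hg)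
  refine ⟨_, h, Set.subset_insert _ _, ?_⟩
  simp [mul_comm]

/-- Every element of a program can be multiplied by a formula at the cost of its size. -/
theorem exists_mul_eval (F : AlgFormula σ) : ∀ {N : ℕ} {S : Set (MvPolynomial σ ℂ)},
    AffineProgram N S → ∀ {g}, g ∈ S →
      ∃ N' S', AffineProgram N' S' ∧ N' ≤ N + F.size ∧ S ⊆ S' ∧ g * F.eval ∈ S' := by
  induction F with
  | const c =>
    intro N S hS g hg
    obtain ⟨S', h1, h2, h3⟩ := hS.exists_mul_of_totalDegree_le_one hg (p := C c) (by simp)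
    exact ⟨_, S', h1, le_rfl, h2, h3⟩
  | var i =>
    intro N S hS g hg
    obtain ⟨S', h1, h2, h3⟩ := hS.exists_mul_of_totalDegree_le_one hg (p := X i) (by simp)
    exact ⟨_, S', h1, le_rfl, h2, h3⟩
  | sum m c f ih =>
    intro N S hS g hg
    -- Every summand is multiplied onto the same `g`; one further step combines the results.
    have key : ∀ s : Finset (Fin (m + 1)), ∃ N' S', AffineProgram N' S' ∧
        N' ≤ N + ∑ i ∈ s, (f i).size ∧ S ⊆ S' ∧ ∀ i ∈ s, g * (f i).eval ∈ S' := by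
      intro s
      induction s using Finset.induction_on with
      | empty => exact ⟨N, S, hS, by simp, subset_rfl, by simp⟩
      | insert i s hi ihs =>
        obtain ⟨N₁, S₁, h1, h2, h3, h4⟩ := ihs
        obtain ⟨N₂, S₂, k1, k2, k3, k4⟩ := ih i h1 (h3 hg)
        refine ⟨N₂, S₂, k1, ?_, h3.trans k3, ?_⟩
        · rw [Finset.sum_insert hi]
          omega
        · intro j hj
          rcases Finset.mem_insert.1 hj with rfl | hj
          · exact k4
          · exact k3 (h4 j hj)
    obtain ⟨N', S', h1, h2, h3, h4⟩ := key Finset.univ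
    refine ⟨N' + 1, _, h1.step (fun i => C (c i)) (fun i => g * (f i).eval) (by simp)
      (fun i => h4 i (Finset.mem_univ i)), ?_, h3.trans (Set.subset_insert _ _),
      Set.mem_insert_iff.2 (Or.inl ?_)⟩
    · simp only [AlgFormula.size]
      omega
    · simp only [AlgFormula.eval, Finset.mul_sum]
      exact Finset.sum_congr rfl fun i _ => mul_left_comm _ _ _
  | prod m f ih =>
    intro N S hS g hg
    -- The factors are chained: each product obtained so far takes the role of `g` for the next
    -- factor.
    have key : ∀ s : Finset (Fin (m + 1)), ∃ N' S', AffineProgram N' S' ∧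
        N' ≤ N + ∑ i ∈ s, (f i).size ∧ S ⊆ S' ∧ g * ∏ i ∈ s, (f i).eval ∈ S' := by
      intro s
      induction s using Finset.induction_on with
      | empty => exact ⟨N, S, hS, by simp, subset_rfl, by simpa using hg⟩
      | insert i s hi ihs =>
        obtain ⟨N₁, S₁, h1, h2, h3, h4⟩ := ihs
        obtain ⟨N₂, S₂, k1, k2, k3, k4⟩ := ih i h1 h4
        refine ⟨N₂, S₂, k1, ?_, h3.trans k3, ?_⟩
        · rw [Finset.sum_insert hi]
          omega
        · rwa [Finset.prod_insert hi, mul_comm (f i).eval, ← mul_assoc]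
    obtain ⟨N', S', h1, h2, h3, h4⟩ := key Finset.univ
    refine ⟨N', S', h1, ?_, h3, h4⟩
    simp only [AlgFormula.size]
    omega

/-- The steps of a program, numbered. -/
theorem exists_sequence {N : ℕ} {S : Set (MvPolynomial σ ℂ)} (hS : AffineProgram N S) :
    0 < N ∧ ∃ (v : ℕ → MvPolynomial σ ℂ) (b : ℕ → ℕ → MvPolynomial σ ℂ), v 0 = 1 ∧
      (∀ k j, (b k j).totalDegree ≤ 1) ∧
      (∀ k < N, 0 < k → v k = ∑ j ∈ Finset.range k, b k j * v j) ∧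
      ∀ g ∈ S, ∃ k < N, v k = g := by
  induction hS with
  | one =>
    exact ⟨one_pos, fun _ => 1, fun _ _ => 0, rfl, by simp, by intros; omega,
      fun g hg => ⟨0, one_pos, hg.symm⟩⟩
  | @step N S hS m a h ha hh ih =>
    obtain ⟨hN, v, b, h0, hb, hv, hmem⟩ := ih
    choose k hk hvk using fun i => hmem _ (hh i)
    refine ⟨by omega, Function.update v N (∑ i, a i * h i),
      -- Several `h i` may be the same numbered element, so their coefficients are added up.
      Function.update b N fun j => ∑ i with k i = j, a i, ?_, ?_, ?_, ?_⟩
    · rw [Function.update_of_ne hN.ne, h0]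
    · intro k' j
      by_cases hk' : k' = N
      · subst hk'
        rw [Function.update_self]
        exact totalDegree_finsetSum_le fun i _ => ha i
      · rw [Function.update_of_ne hk']
        exact hb k' j
    · intro k' hk' hpos
      have hlow : ∀ j ∈ Finset.range k', Function.update v N (∑ i, a i * h i) j = v j :=
        fun j hj => Function.update_of_ne (by have := Finset.mem_range.1 hj; omega) _ _
      refine Eq.trans ?_ (Finset.sum_congr rfl fun j hj => congrArg _ (hlow j hj).symm)
      by_cases hkN : k' = N
      · subst hkN
        simp only [Function.update_self, Finset.sum_mul]
        rw [← Finset.sum_fiberwise_of_maps_to (g := k) (t := Finset.range k')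
          (fun i _ => Finset.mem_range.2 (hk i))]
        refine Finset.sum_congr rfl fun j _ => Finset.sum_congr rfl fun i hi => ?_
        rw [← hvk i, (Finset.mem_filter.1 hi).2]
      · rw [Function.update_of_ne hkN, Function.update_of_ne hkN]
        exact hv k' (by omega) hpos
    · intro g hg
      rcases Set.mem_insert_iff.1 hg with rfl | hg
      · exact ⟨N, by omega, Function.update_self _ _ _⟩
      · obtain ⟨j, hj, rfl⟩ := hmem g hg
        exact ⟨j, by omega, Function.update_of_ne (by omega) _ _⟩

/-- The weight matrix of a numbered program, with a loop at the initial element. -/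
def weight (b : ℕ → ℕ → MvPolynomial σ ℂ) (k j : ℕ) : MvPolynomial σ ℂ :=
  if k = 0 then (if j = 0 then 1 else 0) else if j < k then b k j else 0

/-- Total weight of the walks of a given length to the initial element. -/
def walkSum (b : ℕ → ℕ → MvPolynomial σ ℂ) (N : ℕ) : ℕ → ℕ → MvPolynomial σ ℂ
  | 0, k => if k = 0 then 1 else 0
  | m + 1, k => ∑ j ∈ Finset.range N, weight b k j * walkSum b N m j

theorem totalDegree_weight_le {b : ℕ → ℕ → MvPolynomial σ ℂ} (hb : ∀ k j, (b k j).totalDegree ≤ 1)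
    (k j : ℕ) : (weight b k j).totalDegree ≤ 1 := by
  unfold weight
  split_ifs <;> simp [hb]

/-- Away from `0` the indices strictly decrease, so a walk from `k` needs at most `k` steps; the
loop of weight `1` at `0` pads it to length `m`. -/
theorem walkSum_eq {N : ℕ} (hN : 0 < N) {v : ℕ → MvPolynomial σ ℂ}
    {b : ℕ → ℕ → MvPolynomial σ ℂ} (h0 : v 0 = 1)
    (hv : ∀ k < N, 0 < k → v k = ∑ j ∈ Finset.range k, b k j * v j) (m : ℕ) :
    ∀ k ≤ m, k < N → walkSum b N m k = v k := by
  induction m with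
  | zero =>
    intro k hk _
    obtain rfl : k = 0 := by omega
    simp [walkSum, h0]
  | succ m ih =>
    intro k hk hkN
    rw [walkSum]
    rcases Nat.eq_zero_or_pos k with rfl | hpos
    · rw [Finset.sum_eq_single 0]
      · simp [weight, ih 0 (Nat.zero_le _) hN]
      · intro j _ hj
        simp [weight, hj]
      · simp [hN.ne']
    · rw [hv k hkN hpos]
      have hsub : Finset.range k ⊆ Finset.range N := Finset.range_mono hkN.le
      rw [← Finset.sum_subset hsub]
      · refine Finset.sum_congr rfl fun j hj => ?_
        have hj' := Finset.mem_range.1 hj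
        rw [ih j (by omega) (by omega), weight, if_neg hpos.ne', if_pos hj']
      · intro j _ hj
        rw [weight, if_neg hpos.ne', if_neg (by simpa using hj), zero_mul]

/-- The layered branching program that unrolls a numbered program and computes its element `k`. -/
def toABP (b : ℕ → ℕ → MvPolynomial σ ℂ) (hb : ∀ k j, (b k j).totalDegree ≤ 1) (N k : ℕ) :
    ABP σ where
  len := N
  width i := if (i : ℕ) = 0 ∨ (i : ℕ) = N then 1 else N
  width_source := by simp
  width_sink := by simp
  -- The single source vertex stands for element `k`; the single sink vertex, with index `0`, stands
  -- for the initial element.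
  label i u j := weight b (if (i : ℕ) = 0 then k else u) j
  label_linear i u j := totalDegree_weight_le hb _ _

theorem eval_toABP (b : ℕ → ℕ → MvPolynomial σ ℂ) (hb : ∀ k j, (b k j).totalDegree ≤ 1)
    {N : ℕ} (hN : 0 < N) (k : ℕ) : (toABP b hb N k).eval = walkSum b N N k := by
  rw [(toABP b hb N k).eval_eq_of_recursion
    (fun i u => walkSum b N (N - i) (if (i : ℕ) = 0 then k else u)) ?_ ?_
    ⟨0, by simp [toABP]⟩]
  · simp
  · intro u
    have hu : (u : ℕ) = 0 := by
      have h1 := u.2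
      simp only [toABP, Fin.val_last, or_true, if_true] at h1
      omega
    have hlen : ((Fin.last (toABP b hb N k).len : Fin _) : ℕ) = N := rfl
    rw [hlen, Nat.sub_self, if_neg hN.ne', hu]
    simp [walkSum]
  · intro i u
    have hi : (i : ℕ) < N := i.2
    have hw : (toABP b hb N k).width i.succ = if (i : ℕ) + 1 = N then 1 else N := by
      change (if (i : ℕ) + 1 = 0 ∨ (i : ℕ) + 1 = N then 1 else N) = _
      simp
    obtain ⟨m, hm⟩ : ∃ m, N - i = m + 1 := ⟨N - i - 1, by omega⟩
    simp only [Fin.val_castSucc, Fin.val_succ, Nat.succ_ne_zero, if_false, hm,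
      show N - ((i : ℕ) + 1) = m by omega]
    rw [walkSum]
    have hsum := Fin.sum_univ_eq_sum_range (fun j => weight b (if (i : ℕ) = 0 then k else u) j *
      walkSum b N m j) ((toABP b hb N k).width i.succ)
    refine Eq.trans ?_ hsum.symm
    rw [hw]
    by_cases h : (i : ℕ) + 1 = N
    · obtain rfl : m = 0 := by omega
      rw [if_pos h, Finset.sum_range_one]
      refine Finset.sum_eq_single 0 (fun j _ hj => by simp [walkSum, hj]) (by simp [hN.ne'])
    · rw [if_neg h]

theorem size_toABP_le (b : ℕ → ℕ → MvPolynomial σ ℂ) (hb : ∀ k j, (b k j).totalDegree ≤ 1)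
    {N : ℕ} (hN : 0 < N) (k : ℕ) : (toABP b hb N k).size ≤ (N + 1) * N := by
  have h := Finset.sum_le_card_nsmul Finset.univ (toABP b hb N k).width N fun i _ => by
    simp only [toABP]
    split_ifs <;> omega
  rw [Finset.card_univ, Fintype.card_fin] at h
  exact h

end AffineProgram

theorem AlgFormula.exists_abp {σ : Type} (F : AlgFormula σ) :
    ∃ B : ABP σ, B.eval = F.eval ∧ B.size ≤ (F.size + 2) * (F.size + 1) := by
  obtain ⟨N, S, hS, hN, -, hmem⟩ :=
    AffineProgram.exists_mul_eval F AffineProgram.one (g := 1) (Set.mem_singleton _)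
  rw [one_mul] at hmem
  obtain ⟨hpos, v, b, h0, hb, hv, hex⟩ := hS.exists_sequence
  obtain ⟨k, hk, hvk⟩ := hex _ hmem
  refine ⟨AffineProgram.toABP b hb N k, ?_, (AffineProgram.size_toABP_le b hb hpos k).trans ?_⟩
  · rw [AffineProgram.eval_toABP b hb hpos, AffineProgram.walkSum_eq hpos h0 hv N k hk.le hk, hvk]
  · exact Nat.mul_le_mul (by omega) (by omega)

theorem VF_subset_VBP : VF ⊆ VBP := by
  rintro f ⟨hvars, s, ⟨p, hp⟩, hs⟩
  refine ⟨hvars, fun k => (s k + 2) * (s k + 1), ⟨(p + 2) * (p + 1), fun k => ?_⟩, fun k => ?_⟩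
  · simp only [Polynomial.eval_mul, Polynomial.eval_add, Polynomial.eval_one,
      Polynomial.eval_ofNat]
    have := hp k
    gcongr
  · obtain ⟨F, hF, hsize⟩ := hs k
    obtain ⟨B, hB, hBs⟩ := F.exists_abp
    exact ⟨B, hB.trans hF, hBs.trans (Nat.mul_le_mul (by omega) (by omega))⟩

/-! ### The main theorem -/

theorem Polynomial.eval_nat_mono (p : Polynomial ℕ) {a b : ℕ} (h : a ≤ b) :
    p.eval a ≤ p.eval b := by
  simp only [Polynomial.eval_eq_sum_range]
  gcongr

theorem VBP_subset_VF_of_schurFamily {ℓ : ℕ → ℕ} {lam : ∀ k, Fin (ℓ k) → ℕ} {n : ℕ → ℕ}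
    (hlam : ∀ k, WellSpaced (lam k) (n k)) (hℓ : ∃ p : Polynomial ℕ, ∀ k, k ≤ p.eval (ℓ k))
    (h : (schurFamily lam n).HasPolySizeFormulas) : VBP ⊆ VF := by
  obtain ⟨p, hp⟩ := hℓ
  obtain ⟨s, ⟨r, hr⟩, hs⟩ := h
  rintro f ⟨⟨v, hv⟩, t, ⟨q, hq⟩, ht⟩
  -- Chosen so that `ℓ (index k) > q k`: otherwise `index k ≤ p (ℓ (index k)) ≤ p (q k) < index k`.
  -- The determinant at that index is then large enough for the `k`-th ABP.
  let index : Polynomial ℕ := p.comp q + 1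
  have hindex : ∀ k, index.eval k = p.eval (q.eval k) + 1 := fun k => by simp [index]
  refine ⟨⟨v, hv⟩, fun k => (detFormulaSize.comp (r.comp index) * (v + 2)).eval k,
    ⟨_, fun k => le_rfl⟩, fun k => ?_⟩
  obtain ⟨B, hB, hBs⟩ := ht k
  obtain ⟨F, hF, hFs⟩ := hs (index.eval k)
  have hdet := hasFormula_det_of_hasFormula_schurPoly (hlam (index.eval k))
    ⟨F, hF, hFs.trans (hr _), le_rfl⟩
  have hL : B.size ≤ ℓ (index.eval k) := by
    by_contra hlt
    have h1 := hp (index.eval k)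
    have h2 := p.eval_nat_mono (show ℓ (index.eval k) ≤ q.eval k by have := hq k; omega)
    have h3 := hindex k
    omega
  obtain ⟨G, hG, hGs, -⟩ := B.hasFormula_eval hdet hL
  refine ⟨G, hG.trans hB, hGs.trans ?_⟩
  simp only [Polynomial.eval_mul, Polynomial.eval_add, Polynomial.eval_comp,
    Polynomial.eval_ofNat, Fintype.card_fin]
  have := hv k
  gcongr

theorem exists_wellSpaced_polyBounded : ∃ (ℓ : ℕ → ℕ) (lam : ∀ k, Fin (ℓ k) → ℕ) (n : ℕ → ℕ),
    (∀ k, WellSpaced (lam k) (n k)) ∧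
    (∃ p : Polynomial ℕ, ∀ k, k ≤ p.eval (ℓ k)) ∧ PolyBounded n := by
  -- With `ℓ = k + 1`, all the constraints are equalities: gaps `ℓ - 1 = k`, last part `ℓ`, and `n =
  -- λ_1 + ℓ`.
  refine ⟨fun k => k + 1, fun k i => k + 1 + (k - i) * k, fun k => k + 1 + k * k + (k + 1),
    fun k => ⟨k.succ_pos, ?_, ?_, ?_⟩, ⟨Polynomial.X, fun k => by simp⟩,
    ⟨Polynomial.X + 1 + Polynomial.X * Polynomial.X + (Polynomial.X + 1), fun k => by simp⟩⟩
  · intro i j hij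
    have hj : (j : ℕ) < k + 1 := j.2
    have h1 : k - (i : ℕ) = k - j + 1 := by omega
    simp only [h1, Nat.add_sub_cancel]
    ring_nf
    exact le_rfl
  · intro i _
    simp
  · intro i hi
    simp [hi]

theorem theorem1p1 :
    (∃ (P : Polynomial ℕ) (c : ℕ), ∀ (ℓ : ℕ) (lam : Fin ℓ → ℕ) (n : ℕ), WellSpaced lam n →
      ∀ s Δ : ℕ, HasFormula (schurPoly lam n) s Δ →
        HasFormula (Matrix.mvPolynomialX (Fin ℓ) (Fin ℓ) ℂ).det (P.eval s) (Δ + c)) ∧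
    (∀ (ℓ : ℕ → ℕ) (lam : ∀ k, Fin (ℓ k) → ℕ) (n : ℕ → ℕ),
      (∀ k, WellSpaced (lam k) (n k)) →
      (∃ p : Polynomial ℕ, ∀ k, k ≤ p.eval (ℓ k)) →
      VBP ≠ VF → ¬ (schurFamily lam n).HasPolySizeFormulas) ∧
    (∃ (ℓ : ℕ → ℕ) (lam : ∀ k, Fin (ℓ k) → ℕ) (n : ℕ → ℕ),
      (∀ k, WellSpaced (lam k) (n k)) ∧
      (∃ p : Polynomial ℕ, ∀ k, k ≤ p.eval (ℓ k)) ∧ PolyBounded n) :=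
  ⟨⟨detFormulaSize, 2, fun _ _ _ h _ _ hF => hasFormula_det_of_hasFormula_schurPoly h hF⟩,
    fun _ _ _ hlam hℓ hne h =>
      hne (Set.Subset.antisymm (VBP_subset_VF_of_schurFamily hlam hℓ h) VF_subset_VBP),
    exists_wellSpaced_polyBounded⟩

end
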